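/- Let $E$ be an elliptic curve over $\mathbb{Q}$. A prime number $p$ is called $\mathbb{Q}$-anomalous for $E$ if $E$ has good reduction at $p$ and $\widetilde{E}(\mathbb{F}_p)[p]\neq 0$, where $\widetilde{E}$ denotes the reduction of $E$ at $p$; the curve $E$ is called $\mathbb{Q}$-Ridgdill if it has only finitely many $\mathbb{Q}$-anomalous primes. If the group $E(\mathbb{Q})$ has a nontrivial torsion point, that is, $E(\mathbb{Q})_{\mathrm{tors}}\neq 0$, then $E$ is $\mathbb{Q}$-Ridgdill. -/

import Mathlib

namespace WeierstrassCurve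

/-- `E` has good reduction at the prime `p`: a minimal Weierstrass equation of `E` over `ℚ_p`
(minimal with respect to `ℤ_p`) has unit discriminant. -/
def HasGoodReductionAt (E : WeierstrassCurve ℚ) (p : ℕ) [Fact p.Prime] : Prop :=
  ((E.baseChange ℚ_[p]).minimal ℤ_[p]).HasGoodReduction ℤ_[p]

/-- The reduction of `E` at `p`, as a Weierstrass curve over `𝔽_p = ZMod p`: the coefficients of a
minimal Weierstrass equation of `E` over `ℤ_p` are reduced modulo `p`, the residue field of `ℤ_p`
being identified with `ZMod p`. -/
noncomputable def reductionAt (E : WeierstrassCurve ℚ) (p : ℕ) [Fact p.Prime] :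
    WeierstrassCurve (ZMod p) :=
  (((E.baseChange ℚ_[p]).minimal ℤ_[p]).reduction ℤ_[p]).map
    (PadicInt.residueField (p := p)).toRingHom

/-- A natural number `p` is a `ℚ`-anomalous prime of `E` if it is a prime at which `E` has good
reduction and the group of `𝔽_p`-rational points of the reduction has nonzero `p`-torsion. -/
def IsAnomalousPrime (E : WeierstrassCurve ℚ) (p : ℕ) : Prop :=
  ∃ _ : Fact p.Prime, E.HasGoodReductionAt p ∧
    ∃ P : (E.reductionAt p).toAffine.Point, P ≠ 0 ∧ p • P = 0

/-- `E` is `ℚ`-Ridgdill if it has only finitely many `ℚ`-anomalous primes. -/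
def IsRidgdill (E : WeierstrassCurve ℚ) : Prop :=
  {p : ℕ | E.IsAnomalousPrime p}.Finite

end WeierstrassCurve

/-! ### Cubics over `ZMod p` and Euler's criterion. -/

namespace WeierstrassCurve
open Polynomial

/-! Let `P ≠ 0` be a rational point with `n • P = 0`. For all but finitely many `p` it reduces to a
nonzero point killed by `n`, with `p ∤ n`. If such a `p ≥ 7` were anomalous, `p` would divide the
number of points of the reduction. That number is at most `2p + 1`, so it is `p` or `2p`, and
`card_point_ne_two_mul` rules out `2p` without Hasse's bound. A group of order `p` has no nonzero
point killed by `n`: contradiction.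

No general reduction homomorphism is needed. Only finitely many rational numbers occur in computing
the multiples of `P`; away from finitely many `p` each is zero or a `p`-adic unit, so the addition
formulas reduce term by term. `exists_padicInt_variableChange` carries the count over to the minimal
model. -/

theorem false_of_cubic_pow_eq_one {p : ℕ} [Fact p.Prime] (hp : 7 ≤ p) {c d : ZMod p} (hd : d ≠ 0)
    (h : ∀ t : ZMod p, t ≠ 0 → (t * (4 * t ^ 2 + c * t + d)) ^ (p / 2) = 1) : False := by
  have hp' : p.Prime := Fact.out
  obtain ⟨m, hm⟩ : Odd p := hp'.odd_of_ne_two (by lia)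
  have hpm : p / 2 = m := by lia
  rw [hpm] at h
  have h2 : (2 : ZMod p) ≠ 0 := by
    have := (ZMod.natCast_eq_zero_iff 2 p).not.mpr fun h ↦ by
      have := Nat.le_of_dvd (by simp) h
      lia
    simpa using this
  have hm0 : (m : ZMod p) ≠ 0 := (ZMod.natCast_eq_zero_iff m p).not.mpr fun h ↦ by
    have := Nat.le_of_dvd (by lia) h
    lia
  have h4 : (4 : ZMod p) ≠ 0 := by
    have : (4 : ZMod p) = 2 * 2 := by norm_num
    rw [this]
    exact mul_ne_zero h2 h2
  have h4m : (4 : ZMod p) ^ m = 1 := by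
    have : (4 : ZMod p) ^ m = 2 ^ (p - 1) := by
      rw [show p - 1 = 2 * m by lia, pow_mul]
      norm_num
    rw [this, ZMod.pow_card_sub_one_eq_one h2]
  set g : (ZMod p)[X] := C 4 * X ^ 2 + C c * X + C d with hg
  have hgdeg : g.degree = 2 := degree_quadratic h4
  have hglead : g.leadingCoeff = 4 := leadingCoeff_quadratic h4
  have hXm : (X ^ m - 1 : (ZMod p)[X]).degree < (X ^ (2 * m) : (ZMod p)[X]).degree := by
    rw [degree_X_pow]
    refine (degree_sub_le _ _).trans_lt (max_lt ?_ ?_)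
    · rw [degree_X_pow]
      exact_mod_cast (by lia : m < 2 * m)
    · rw [degree_one]
      exact_mod_cast (by lia : 0 < 2 * m)
  -- For `t ≠ 0` the hypothesis and `t ^ (2m) = 1` give `g(t) ^ m = t ^ m`. Both sides have degree
  -- `2m` and leading coefficient `1 = 4 ^ m`, so agreement at the `2m` nonzero points suffices.
  have key : g ^ m = X ^ (2 * m) + (X ^ m - 1) := by
    refine eq_of_degree_sub_lt_of_eval_finset_eq (Finset.univ.erase 0) ?_ ?_
    · have hcard : (Finset.univ.erase (0 : ZMod p)).card = 2 * m := by
        rw [Finset.card_erase_of_mem (Finset.mem_univ _), Finset.card_univ, ZMod.card]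
        lia
      have hgd : (g ^ m).degree = (2 * m : ℕ) := by
        rw [degree_pow, hgdeg, mul_comm]
        simp
      have hrd : (X ^ (2 * m) + (X ^ m - 1) : (ZMod p)[X]).degree = (2 * m : ℕ) := by
        rw [degree_add_eq_left_of_degree_lt hXm, degree_X_pow]
      rw [hcard, ← hgd]
      refine degree_sub_lt_left (hgd.trans hrd.symm) ?_ ?_
      · intro h0
        rw [h0, degree_zero] at hgd
        exact WithBot.bot_ne_natCast _ hgd
      · rw [leadingCoeff_pow, hglead, h4m, leadingCoeff_add_of_degree_lt' hXm]
        simp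
    · intro t ht
      have ht : t ≠ 0 := by simpa using ht
      have h1 : t ^ (2 * m) = 1 := by
        rw [show 2 * m = p - 1 by lia, ZMod.pow_card_sub_one_eq_one ht]
      have h3 := h t ht
      rw [mul_pow] at h3
      have h5 : t ^ m * t ^ m = 1 := by rw [← pow_add, ← two_mul, h1]
      simp only [hg, eval_pow, eval_add, eval_mul, eval_C, eval_X, eval_sub, eval_one, h1]
      linear_combination t ^ m * h3 - (4 * t ^ 2 + c * t + d) ^ m * h5
  have hder := congrArg derivative key
  obtain ⟨k, rfl⟩ : ∃ k, m = k + 1 := ⟨m - 1, by lia⟩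
  -- Differentiating `key` shows that `X ^ k` divides `(k + 1) g ^ k g'`, and `g` is prime to `X`
  -- because `d ≠ 0`. Since `p ≥ 7` gives `k ≥ 2`, the linear polynomial `g'` cannot be such a
  -- multiple.
  have hdvd : (X : (ZMod p)[X]) ^ k ∣ C (8 : ZMod p) * X + C c := by
    have hcop : IsCoprime ((X : (ZMod p)[X]) ^ k) (C ((k + 1 : ℕ) : ZMod p) * g ^ k) := by
      refine IsCoprime.pow_left (IsCoprime.mul_right ?_ (IsCoprime.pow_right ?_))
      · exact ⟨0, C ((k + 1 : ℕ) : ZMod p)⁻¹, by rw [← C_mul, inv_mul_cancel₀ hm0, C_1]; ring⟩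
      · refine ⟨-C d⁻¹ * (C 4 * X + C c), C d⁻¹, ?_⟩
        have : (C d⁻¹ * C d : (ZMod p)[X]) = 1 := by rw [← C_mul, inv_mul_cancel₀ hd, C_1]
        rw [hg]
        linear_combination this
    refine hcop.dvd_of_dvd_mul_left ?_
    have hg' : derivative g = C (8 : ZMod p) * X + C c := by
      simp only [hg, derivative_add, derivative_C_mul_X_sq, derivative_C_mul_X, derivative_C,
        add_zero]
      norm_num
    rw [derivative_pow, hg'] at hder
    refine ⟨C ((2 * (k + 1) : ℕ) : ZMod p) * X ^ (k + 1) + C ((k + 1 : ℕ) : ZMod p), ?_⟩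
    rw [Nat.add_sub_cancel] at hder
    rw [hder, derivative_add, derivative_sub, derivative_X_pow, derivative_X_pow, derivative_one,
      show 2 * (k + 1) - 1 = k + (k + 1) by lia, Nat.add_sub_cancel, pow_add X k (k + 1)]
    ring
  have hne : (C (8 : ZMod p) * X + C c) ≠ 0 := by
    intro h0
    have := congrArg (coeff · 1) h0
    simp at this
    have h8 : (8 : ZMod p) = 2 * 4 := by norm_num
    exact mul_ne_zero h2 h4 (h8 ▸ this)
  have := natDegree_le_of_dvd hdvd hne
  rw [natDegree_X_pow] at this
  have := this.trans (natDegree_linear_le)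
  lia

end WeierstrassCurve

/-! ### Counting points over finite fields. -/

namespace WeierstrassCurve
open WeierstrassCurve.Affine

theorem card_point_eq_sum {F : Type*} [Field F] [Fintype F] [DecidableEq F]
    (W : WeierstrassCurve F) [W.IsElliptic] :
    Nat.card W.toAffine.Point = 1 + ∑ x, Nat.card {y // W.toAffine.Equation x y} := by
  classical
  have e : {P : F × F // W.toAffine.Equation P.1 P.2} ≃ Σ x, {y // W.toAffine.Equation x y} :=
    { toFun P := ⟨P.1.1, P.1.2, P.2⟩
      invFun P := ⟨(P.1, P.2.1), P.2.2⟩ }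
  rw [Nat.card_congr ((pointEquiv (W' := W.toAffine)).trans (Equiv.optionCongr e)),
    Finite.card_option, Nat.card_sigma, add_comm]

theorem card_equation_le_two {F : Type*} [Field F] [Finite F]
    (W : WeierstrassCurve F) (x : F) : Nat.card {y // W.toAffine.Equation x y} ≤ 2 := by
  classical
  rcases isEmpty_or_nonempty {y // W.toAffine.Equation x y} with h | ⟨⟨y₀, h₀⟩⟩
  · simp
  · have hsub : {y | W.toAffine.Equation x y} ⊆ ({y₀, W.toAffine.negY x y₀} : Finset F) := by
      intro y hy
      simpa using Y_eq_of_X_eq hy h₀ rfl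
    calc Nat.card {y | W.toAffine.Equation x y}
        ≤ Nat.card ({y₀, W.toAffine.negY x y₀} : Finset F) := Nat.card_mono (Set.toFinite _) hsub
      _ ≤ 2 := by rw [Nat.card_eq_finsetCard]; exact Finset.card_le_two

theorem card_point_le {F : Type*} [Field F] [Finite F] (W : WeierstrassCurve F) [W.IsElliptic] :
    Nat.card W.toAffine.Point ≤ 2 * Nat.card F + 1 := by
  classical
  have := Fintype.ofFinite F
  rw [card_point_eq_sum, add_comm, mul_comm]
  gcongr
  simpa using Finset.sum_le_card_nsmul Finset.univ _ 2 fun x _ ↦ W.card_equation_le_two x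

theorem card_equation_le_one_of_eq_negY {F : Type*} [Field F] [Finite F] (W : WeierstrassCurve F)
    {x y : F} (h : W.toAffine.Equation x y) (hy : y = W.toAffine.negY x y) :
    Nat.card {y // W.toAffine.Equation x y} ≤ 1 := by
  refine Finite.card_le_one_iff_subsingleton.mpr ⟨fun ⟨y₁, h₁⟩ ⟨y₂, h₂⟩ ↦ Subtype.ext ?_⟩
  have := Y_eq_of_X_eq h₁ h rfl
  have := Y_eq_of_X_eq h₂ h rfl
  grind

theorem exists_equation_ne_negY {F : Type*} [Field F] (W : WeierstrassCurve F) {x : F}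
    (h : Nat.card {y // W.toAffine.Equation x y} = 2) :
    ∃ y, W.toAffine.Equation x y ∧ y ≠ W.toAffine.negY x y := by
  obtain ⟨⟨y₁, h₁⟩, ⟨y₂, h₂⟩, hne, -⟩ := Nat.card_eq_two_iff.mp h
  refine ⟨y₁, h₁, fun hy ↦ hne (Subtype.ext ?_)⟩
  have := Y_eq_of_X_eq h₂ h₁ rfl
  grind

/-- An even count yields a 2-torsion point, whose `x`-fibre is a single point. Having `2p - 1`
affine points then forces every other fibre to have two, so the cubic of the completed square takes
nonzero square values off its root `x₀`. -/
theorem card_point_ne_two_mul {p : ℕ} [Fact p.Prime] (hp : 7 ≤ p) (W : WeierstrassCurve (ZMod p))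
    [W.IsElliptic] : Nat.card W.toAffine.Point ≠ 2 * p := by
  intro hcard
  have hp' : p.Prime := Fact.out
  have : Finite W.toAffine.Point := Nat.finite_of_card_ne_zero (by lia)
  obtain ⟨P, hP⟩ := exists_prime_addOrderOf_dvd_card' (G := W.toAffine.Point) 2 (hcard ▸ ⟨p, rfl⟩)
  have hPP : P + P = 0 := by rw [← two_nsmul, ← hP, addOrderOf_nsmul_eq_zero]
  rcases P with _ | ⟨x₀, y₀, h₀⟩
  · rw [← Point.zero_def, addOrderOf_zero] at hP
    lia
  have hy₀ : y₀ = W.toAffine.negY x₀ y₀ := by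
    by_contra hne
    rw [Point.add_self_of_Y_ne hne] at hPP
    exact Point.some_ne_zero _ hPP
  have hall (x : ZMod p) (hx : x ≠ x₀) : Nat.card {y // W.toAffine.Equation x y} = 2 := by
    refine (W.card_equation_le_two x).antisymm (not_lt.mp fun hlt ↦ ?_)
    have hsum : ∑ x, Nat.card {y // W.toAffine.Equation x y} = 2 * p - 1 := by
      rw [card_point_eq_sum] at hcard
      lia
    rw [← Finset.add_sum_erase _ _ (Finset.mem_univ x₀),
      ← Finset.add_sum_erase _ _ (Finset.mem_erase.mpr ⟨hx, Finset.mem_univ x⟩)] at hsum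
    have h1 := W.card_equation_le_one_of_eq_negY h₀.1 hy₀
    have h2 := Finset.sum_le_card_nsmul ((Finset.univ.erase x₀).erase x) _ 2
      fun x _ ↦ W.card_equation_le_two x
    rw [Finset.card_erase_of_mem (Finset.mem_erase.mpr ⟨hx, Finset.mem_univ x⟩),
      Finset.card_erase_of_mem (Finset.mem_univ _), Finset.card_univ, ZMod.card, smul_eq_mul] at h2
    lia
  have hz₀ : 2 * y₀ + W.a₁ * x₀ + W.a₃ = 0 := by
    rw [negY] at hy₀
    linear_combination hy₀
  have heq₀ := (W.toAffine.equation_iff' x₀ y₀).mp h₀.1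
  have hd : 12 * x₀ ^ 2 + 2 * W.b₂ * x₀ + 2 * W.b₄ ≠ 0 := by
    have h4 : (4 : ZMod p) ≠ 0 := by
      have := (ZMod.natCast_eq_zero_iff 4 p).not.mpr fun h ↦ by
        have := Nat.le_of_dvd (by simp) h
        lia
      simpa using this
    rcases ((W.toAffine.nonsingular_iff' x₀ y₀).mp h₀).2 with h | h
    · intro h0
      refine h ((mul_eq_zero_iff_left h4).mp ?_)
      rw [b₂, b₄] at h0
      linear_combination 2 * W.a₁ * hz₀ - h0
    · exact absurd hz₀ h
  -- Expansion of `4x³ + b₂x² + 2b₄x + b₆` at its root `x₀`, with `x = x₀ + t`; `d` is the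
  -- derivative there, nonzero by nonsingularity.
  refine false_of_cubic_pow_eq_one hp (c := 12 * x₀ + W.b₂) hd fun t ht ↦ ?_
  obtain ⟨y, hy, hne⟩ := W.exists_equation_ne_negY (hall (x₀ + t) (by simpa using ht))
  have hz : 2 * y + W.a₁ * (x₀ + t) + W.a₃ ≠ 0 := by
    rw [negY, ← sub_ne_zero] at hne
    convert hne using 1
    ring
  have heq := (W.toAffine.equation_iff' _ _).mp hy
  have hsq : t * (4 * t ^ 2 + (12 * x₀ + W.b₂) * t + (12 * x₀ ^ 2 + 2 * W.b₂ * x₀ + 2 * W.b₄)) =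
      (2 * y + W.a₁ * (x₀ + t) + W.a₃) ^ 2 := by
    rw [b₂, b₄]
    linear_combination 4 * heq₀ - 4 * heq - (2 * y₀ + W.a₁ * x₀ + W.a₃) * hz₀
  obtain ⟨m, hm⟩ : Odd p := hp'.odd_of_ne_two (by lia)
  rw [hsq, ← pow_mul, show 2 * (p / 2) = p - 1 by lia, ZMod.pow_card_sub_one_eq_one hz]

theorem card_point_eq_of_dvd {p : ℕ} [Fact p.Prime] (hp : 7 ≤ p) (W : WeierstrassCurve (ZMod p))
    [W.IsElliptic] (h : p ∣ Nat.card W.toAffine.Point) : Nat.card W.toAffine.Point = p := by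
  have hle := W.card_point_le
  have hne := W.card_point_ne_two_mul hp
  rw [Nat.card_zmod] at hle
  have hpos : Nat.card W.toAffine.Point ≠ 0 := by
    rw [card_point_eq_sum]
    lia
  obtain ⟨k, hk⟩ := h
  rw [hk] at hle hne hpos ⊢
  have : k < 3 := by
    by_contra! h3
    have := Nat.mul_le_mul_left p h3
    lia
  interval_cases k <;> lia

end WeierstrassCurve

/-! ### Changes of variables and good models. -/

namespace WeierstrassCurve

theorem equation_variableChange_iff {F : Type*} [Field F] (W : WeierstrassCurve F)
    (C : VariableChange F) (x y : F) :
    (C • W).toAffine.Equation x y ↔ W.toAffine.Equation (C.u ^ 2 * x + C.r)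
      (C.u ^ 3 * y + C.u ^ 2 * C.s * x + C.t) := by
  have hu : (C.u : F) ≠ 0 := C.u.ne_zero
  rw [Affine.equation_iff', Affine.equation_iff', ← mul_eq_zero_iff_left (pow_ne_zero 6 hu)]
  simp only [variableChange_a₁, variableChange_a₂, variableChange_a₃, variableChange_a₄,
    variableChange_a₆, Units.val_inv_eq_inv_val]
  refine Eq.congr_left ?_
  field_simp
  ring

def equationEquivVariableChange {F : Type*} [Field F] (W : WeierstrassCurve F)
    (C : VariableChange F) :
    {P : F × F // (C • W).toAffine.Equation P.1 P.2} ≃ {P : F × F // W.toAffine.Equation P.1 P.2} :=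
  Equiv.subtypeEquiv
    { toFun P := (C.u ^ 2 * P.1 + C.r, C.u ^ 3 * P.2 + C.u ^ 2 * C.s * P.1 + C.t)
      invFun Q := ((C.u : F)⁻¹ ^ 2 * (Q.1 - C.r),
        (C.u : F)⁻¹ ^ 3 * (Q.2 - C.s * (Q.1 - C.r) - C.t))
      left_inv P := by
        have hu : (C.u : F) ≠ 0 := C.u.ne_zero
        ext
        · simp
        · simp
          field_simp
          ring
      right_inv Q := by
        have hu : (C.u : F) ≠ 0 := C.u.ne_zero
        ext
        · simp
        · simp
          field_simp
          ring }
    fun P ↦ W.equation_variableChange_iff C P.1 P.2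

theorem card_point_variableChange {F : Type*} [Field F] (W : WeierstrassCurve F) [W.IsElliptic]
    (C : VariableChange F) : Nat.card (C • W).toAffine.Point = Nat.card W.toAffine.Point :=
  Nat.card_congr <| (Affine.pointEquiv (W' := (C • W).toAffine)).trans <|
    (Equiv.optionCongr (W.equationEquivVariableChange C)).trans
      (Affine.pointEquiv (W' := W.toAffine)).symm

/-- Comparing discriminants makes `u` a unit. The formulas for `b₂`, `a₁`, `a₃` then bound `12r`,
`2s`, `2t` in turn, and 2 and 3 are units. -/
theorem exists_padicInt_variableChange {p : ℕ} [Fact p.Prime] (hp : 5 ≤ p)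
    {W W' : WeierstrassCurve ℤ_[p]} (hW : IsUnit W.Δ) (hW' : IsUnit W'.Δ)
    {C : VariableChange ℚ_[p]} (hC : C • (W⁄ℚ_[p]) = W'⁄ℚ_[p]) :
    ∃ D : VariableChange ℤ_[p], D • W = W' := by
  have hp' : p.Prime := Fact.out
  have hu0 : (C.u : ℚ_[p]) ≠ 0 := C.u.ne_zero
  have hinj : Function.Injective (algebraMap ℤ_[p] ℚ_[p]) := IsFractionRing.injective _ _
  have norm_le (z : ℤ_[p]) : ‖algebraMap ℤ_[p] ℚ_[p] z‖ ≤ 1 := z.2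
  have lift {x : ℚ_[p]} (hx : ‖x‖ ≤ 1) : ∃ z : ℤ_[p], algebraMap ℤ_[p] ℚ_[p] z = x := ⟨⟨x, hx⟩, rfl⟩
  have h2 : ‖(2 : ℚ_[p])‖ = 1 := by
    have := (Padic.norm_natCast_eq_one_iff (p := p) (n := 2)).mpr
      ((Nat.coprime_primes hp' Nat.prime_two).mpr (by lia))
    simpa using this
  have h3 : ‖(3 : ℚ_[p])‖ = 1 := by
    have := (Padic.norm_natCast_eq_one_iff (p := p) (n := 3)).mpr
      ((Nat.coprime_primes hp' Nat.prime_three).mpr (by lia))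
    simpa using this
  have h12 : ‖(12 : ℚ_[p])‖ = 1 := by
    rw [show (12 : ℚ_[p]) = 2 * 2 * 3 by norm_num, norm_mul, norm_mul, h2, h3]
    norm_num
  have hu : ‖(C.u : ℚ_[p])‖ = 1 := by
    have hΔ := congrArg (fun V ↦ ‖V.Δ‖) hC
    simp only [variableChange_Δ, baseChange, map_Δ, norm_mul, norm_pow,
      Units.val_inv_eq_inv_val, norm_inv] at hΔ
    have e1 : ‖algebraMap ℤ_[p] ℚ_[p] W.Δ‖ = 1 := PadicInt.isUnit_iff.mp hW
    have e2 : ‖algebraMap ℤ_[p] ℚ_[p] W'.Δ‖ = 1 := PadicInt.isUnit_iff.mp hW'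
    rw [e1, e2, mul_one, pow_eq_one_iff_of_nonneg (by positivity) (by simp), inv_eq_one] at hΔ
    exact hΔ
  have bound {n x a b : ℚ_[p]} {k : ℕ} (hn : ‖n‖ = 1) (ha : ‖a‖ ≤ 1) (hb : ‖b‖ ≤ 1)
      (h : (C.u : ℚ_[p])⁻¹ ^ k * (a + n * x) = b) : ‖x‖ ≤ 1 := by
    have e : n * x = C.u ^ k * b - a := by
      rw [← h, inv_pow, mul_inv_cancel_left₀ (pow_ne_zero k hu0), add_sub_cancel_left]
    have hx : ‖x‖ = ‖n * x‖ := by rw [norm_mul, hn, one_mul]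
    rw [hx, e, sub_eq_add_neg]
    refine (Padic.nonarchimedean _ _).trans (max_le ?_ (by rwa [norm_neg]))
    rw [norm_mul, norm_pow, hu, one_pow, one_mul]
    exact hb
  have hr : ‖C.r‖ ≤ 1 := by
    have h := congrArg b₂ hC
    simp only [variableChange_b₂, baseChange, map_b₂, Units.val_inv_eq_inv_val] at h
    exact bound h12 (norm_le _) (norm_le _) h
  obtain ⟨r, hr⟩ := lift hr
  have hs : ‖C.s‖ ≤ 1 := by
    have h := congrArg a₁ hC
    simp only [variableChange_a₁, baseChange, map_a₁, Units.val_inv_eq_inv_val] at h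
    exact bound (k := 1) h2 (norm_le W.a₁) (norm_le W'.a₁) (by rw [← h, pow_one])
  obtain ⟨s, hs⟩ := lift hs
  have ht : ‖C.t‖ ≤ 1 := by
    have h := congrArg a₃ hC
    simp only [variableChange_a₃, baseChange, map_a₃, Units.val_inv_eq_inv_val] at h
    refine bound (k := 3) h2 (norm_le (W.a₃ + r * W.a₁)) (norm_le _) (Eq.trans ?_ h)
    rw [map_add, map_mul, hr, map_a₁]
  obtain ⟨t, ht⟩ := lift ht
  let u : ℤ_[p]ˣ := PadicInt.mkUnits hu
  have hCD : C = (⟨u, r, s, t⟩ : VariableChange ℤ_[p]).map (algebraMap ℤ_[p] ℚ_[p]) := by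
    ext
    · rfl
    · exact hr.symm
    · exact hs.symm
    · exact ht.symm
  refine ⟨⟨u, r, s, t⟩, map_injective hinj ?_⟩
  exact (map_variableChange W ⟨u, r, s, t⟩ (algebraMap ℤ_[p] ℚ_[p])).symm.trans (hCD ▸ hC)

end WeierstrassCurve

/-! ### Reduction of points along a ring homomorphism. -/

namespace WeierstrassCurve

/-- `x` is zero or comes from a unit of `R`. -/
def IsZeroOrUnit (R : Type*) {K : Type*} [CommRing R] [Field K] [Algebra R K] (x : K) : Prop :=
  x = 0 ∨ ∃ u : Rˣ, algebraMap R K u = x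

variable {R K k : Type*} [CommRing R] [Field K] [Field k] [Algebra R K]

theorem IsZeroOrUnit.exists_eq {x : K} (h : IsZeroOrUnit R x) : ∃ r : R, algebraMap R K r = x := by
  rcases h with rfl | ⟨u, hu⟩
  · exact ⟨0, map_zero _⟩
  · exact ⟨u, hu⟩

theorem isUnit_of_isZeroOrUnit (hinj : Function.Injective (algebraMap R K)) {r : R} (hr : r ≠ 0)
    (h : IsZeroOrUnit R (algebraMap R K r)) : IsUnit r := by
  rcases h with h | ⟨u, hu⟩
  · exact absurd ((map_eq_zero_iff _ hinj).mp h) hr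
  · exact hinj hu ▸ u.isUnit

/-- The point `P` has coordinates in `R`, whose images under `φ` are those of `P'`. -/
def ReducesTo (W : WeierstrassCurve R) (φ : R →+* k) (P : (W⁄K).toAffine.Point)
    (P' : (W.map φ).toAffine.Point) : Prop :=
  (P = 0 ∧ P' = 0) ∨ ∃ x y h h', P = .some (algebraMap R K x) (algebraMap R K y) h ∧
    P' = .some (φ x) (φ y) h'

theorem ReducesTo.some_some (W : WeierstrassCurve R) (φ : R →+* k) {x y : R}
    (h : (W⁄K).toAffine.Nonsingular (algebraMap R K x) (algebraMap R K y))
    (h' : (W.map φ).toAffine.Nonsingular (φ x) (φ y)) :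
    W.ReducesTo φ (.some _ _ h : (W⁄K).toAffine.Point) (.some _ _ h') :=
  .inr ⟨x, y, h, h', rfl, rfl⟩

/-- The `x`-coordinate of a point, with value `0` at infinity. -/
def xCoord {F : Type*} [CommRing F] {W : WeierstrassCurve F} : W.toAffine.Point → F
  | .zero => 0
  | .some x _ _ => x

/-- The `y`-coordinate of a point, with value `0` at infinity. -/
def yCoord {F : Type*} [CommRing F] {W : WeierstrassCurve F} : W.toAffine.Point → F
  | .zero => 0
  | .some _ y _ => y

open WeierstrassCurve.Affine

theorem reducesTo_some_add_some (W : WeierstrassCurve R) (φ : R →+* k) [DecidableEq K]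
    [DecidableEq k] {x₁ y₁ x₂ y₂ l : R} {h₁ h₂} {h₁' h₂'}
    (hxy : ¬(algebraMap R K x₁ = algebraMap R K x₂ ∧
      algebraMap R K y₁ = (W⁄K).toAffine.negY (algebraMap R K x₂) (algebraMap R K y₂)))
    (hxy' : ¬(φ x₁ = φ x₂ ∧ φ y₁ = (W.map φ).toAffine.negY (φ x₂) (φ y₂)))
    (hl : (W⁄K).toAffine.slope (algebraMap R K x₁) (algebraMap R K x₂) (algebraMap R K y₁)
      (algebraMap R K y₂) = algebraMap R K l)
    (hl' : (W.map φ).toAffine.slope (φ x₁) (φ x₂) (φ y₁) (φ y₂) = φ l) :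
    W.ReducesTo φ (Point.some (W' := (W⁄K).toAffine) (algebraMap R K x₁) (algebraMap R K y₁) h₁ +
        Point.some (algebraMap R K x₂) (algebraMap R K y₂) h₂)
      (Point.some (W' := (W.map φ).toAffine) (φ x₁) (φ y₁) h₁' + Point.some (φ x₂) (φ y₂) h₂') := by
  rw [Point.add_some hxy, Point.add_some hxy']
  refine .inr ⟨W.toAffine.addX x₁ x₂ l, W.toAffine.addY x₁ x₂ y₁ l, ?_, ?_, ?_, ?_⟩
  · rw [← map_addX, ← map_addY, ← hl]
    exact nonsingular_add h₁ h₂ hxy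
  · rw [← map_addX, ← map_addY, ← hl']
    exact nonsingular_add h₁' h₂' hxy'
  · congr 1
    · rw [← map_addX, ← hl]; rfl
    · rw [← map_addY, ← hl]; rfl
  · congr 1
    · rw [← map_addX, ← hl']
    · rw [← map_addY, ← hl']

/-- A nonzero difference, being a unit, stays nonzero under `φ`. Hence the same case of the addition
law applies on both sides, and the slope has a unit denominator. -/
theorem ReducesTo.add (hinj : Function.Injective (algebraMap R K)) (W : WeierstrassCurve R)
    (φ : R →+* k) [DecidableEq K] [DecidableEq k] {P Q : (W⁄K).toAffine.Point}
    {P' Q' : (W.map φ).toAffine.Point} (hP : W.ReducesTo φ P P') (hQ : W.ReducesTo φ Q Q')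
    (hx : IsZeroOrUnit R (xCoord P - xCoord Q))
    (hy : IsZeroOrUnit R (yCoord P - (W⁄K).toAffine.negY (xCoord Q) (yCoord Q))) :
    W.ReducesTo φ (P + Q) (P' + Q') := by
  rcases hP with ⟨rfl, rfl⟩ | ⟨x₁, y₁, h₁, h₁', rfl, rfl⟩
  · simpa using hQ
  rcases hQ with ⟨rfl, rfl⟩ | ⟨x₂, y₂, h₂, h₂', rfl, rfl⟩
  · simpa using ReducesTo.some_some W φ h₁ h₁'
  simp only [xCoord, yCoord] at hx hy
  have hneg : (W⁄K).toAffine.negY (algebraMap R K x₂) (algebraMap R K y₂) =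
      algebraMap R K (W.toAffine.negY x₂ y₂) := map_negY ..
  rw [hneg, ← map_sub] at hy
  rw [← map_sub] at hx
  have hneg' : (W.map φ).toAffine.negY (φ x₂) (φ y₂) = φ (W.toAffine.negY x₂ y₂) := map_negY ..
  by_cases hxe : x₁ = x₂
  · subst hxe
    by_cases hye : y₁ = W.toAffine.negY x₁ y₂
    · refine .inl ⟨Point.add_of_Y_eq rfl ?_, Point.add_of_Y_eq rfl ?_⟩
      · rw [hneg, ← hye]
      · rw [hneg', ← hye]
    · obtain ⟨v, hv⟩ := isUnit_of_isZeroOrUnit hinj (sub_ne_zero.mpr hye) hy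
      have hne : algebraMap R K y₁ ≠
          (W⁄K).toAffine.negY (algebraMap R K x₁) (algebraMap R K y₂) := by
        rw [hneg]; exact hinj.ne hye
      have hvφ : φ v ≠ 0 := (v.isUnit.map φ).ne_zero
      have hne' : φ y₁ ≠ (W.map φ).toAffine.negY (φ x₁) (φ y₂) := by
        rw [hneg', ← sub_ne_zero, ← map_sub, ← hv]; exact hvφ
      obtain rfl : y₁ = y₂ := hinj (Y_eq_of_Y_ne h₁.1 h₂.1 rfl hne)
      refine reducesTo_some_add_some W φ
        (l := (3 * x₁ ^ 2 + 2 * W.a₂ * x₁ + W.a₄ - W.a₁ * y₁) * ↑v⁻¹)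
        (fun h ↦ hne h.2) (fun h ↦ hne' h.2) ?_ ?_
      · rw [slope_of_Y_ne rfl hne, hneg, ← map_sub, ← hv,
          div_eq_iff ((v.isUnit.map (algebraMap R K)).ne_zero), ← map_mul, mul_assoc _ _ (v : R),
          Units.inv_mul, mul_one]
        simp only [baseChange, map_sub, map_add, map_mul, map_pow, map_ofNat, map_a₁, map_a₂, map_a₄]
      · rw [slope_of_Y_ne rfl hne', hneg', ← map_sub, ← hv, div_eq_iff hvφ, ← map_mul, mul_assoc _ _ (v : R),
          Units.inv_mul, mul_one]
        simp only [map_sub, map_add, map_mul, map_pow, map_ofNat, map_a₁, map_a₂, map_a₄]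
  · obtain ⟨v, hv⟩ := isUnit_of_isZeroOrUnit hinj (sub_ne_zero.mpr hxe) hx
    have hne : algebraMap R K x₁ ≠ algebraMap R K x₂ := hinj.ne hxe
    have hvφ : φ v ≠ 0 := (v.isUnit.map φ).ne_zero
    have hne' : φ x₁ ≠ φ x₂ := by
      rw [← sub_ne_zero, ← map_sub, ← hv]; exact hvφ
    refine reducesTo_some_add_some W φ (l := (y₁ - y₂) * ↑v⁻¹)
      (fun h ↦ hne h.1) (fun h ↦ hne' h.1) ?_ ?_
    · rw [slope_of_X_ne hne, ← map_sub, ← map_sub, ← hv,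
          div_eq_iff ((v.isUnit.map (algebraMap R K)).ne_zero), ← map_mul, mul_assoc,
          Units.inv_mul, mul_one]
    · rw [slope_of_X_ne hne', ← map_sub, ← map_sub, ← hv, div_eq_iff hvφ, ← map_mul, mul_assoc,
          Units.inv_mul, mul_one]

theorem exists_reducesTo_some (W : WeierstrassCurve R) (φ : R →+* k) [(W.map φ).IsElliptic]
    (hinj : Function.Injective (algebraMap R K)) {x y : K} (h : (W⁄K).toAffine.Nonsingular x y)
    (hx : IsZeroOrUnit R x) (hy : IsZeroOrUnit R y) :
    ∃ P' : (W.map φ).toAffine.Point, P' ≠ 0 ∧ W.ReducesTo φ (.some x y h) P' := by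
  obtain ⟨x, rfl⟩ := hx.exists_eq
  obtain ⟨y, rfl⟩ := hy.exists_eq
  have h' : (W.map φ).toAffine.Nonsingular (φ x) (φ y) :=
    equation_iff_nonsingular.mp (((map_equation W hinj x y).mp h.1).map φ)
  exact ⟨.some _ _ h', Point.some_ne_zero h', .some_some W φ h h'⟩

theorem exists_nsmul_eq_zero_of_isZeroOrUnit (W : WeierstrassCurve R) {V : WeierstrassCurve K}
    (hV : W⁄K = V) (φ : R →+* k)
    [(W.map φ).IsElliptic] [DecidableEq K] [DecidableEq k]
    (hinj : Function.Injective (algebraMap R K)) {P : V.toAffine.Point} (hP : P ≠ 0) {n : ℕ}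
    (hn : n • P = 0) (hPx : IsZeroOrUnit R (xCoord P)) (hPy : IsZeroOrUnit R (yCoord P))
    (hx : ∀ m : ℕ, IsZeroOrUnit R (xCoord (m • P) - xCoord P))
    (hy : ∀ m : ℕ, IsZeroOrUnit R
      (yCoord (m • P) - V.toAffine.negY (xCoord P) (yCoord P))) :
    ∃ P' : (W.map φ).toAffine.Point, P' ≠ 0 ∧ n • P' = 0 := by
  subst hV
  obtain ⟨P', hP', hred⟩ : ∃ P' : (W.map φ).toAffine.Point, P' ≠ 0 ∧ W.ReducesTo φ P P' := by
    rcases P with _ | ⟨x, y, h⟩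
    · exact absurd rfl hP
    · exact exists_reducesTo_some W φ hinj h hPx hPy
  have hmul (m : ℕ) : W.ReducesTo φ (m • P) (m • P') := by
    induction m with
    | zero => exact .inl ⟨zero_smul _ _, zero_smul _ _⟩
    | succ m ih =>
      rw [succ_nsmul, succ_nsmul]
      exact ReducesTo.add hinj W φ ih hred (hx m) (hy m)
  refine ⟨P', hP', ?_⟩
  rcases hmul n with h | ⟨x, y, h, -, he, -⟩
  · exact h.2
  · exact absurd (he.symm.trans hn) (Point.some_ne_zero h)

end WeierstrassCurve

/-! ### Excluding finitely many primes. -/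

namespace WeierstrassCurve
open Filter

theorem eventually_isZeroOrUnit (q : ℚ) : ∀ᶠ p : ℕ in cofinite, ∀ _ : Fact p.Prime,
    IsZeroOrUnit ℤ_[p] (algebraMap ℚ ℚ_[p] q) := by
  by_cases hq : q = 0
  · exact .of_forall fun p _ ↦ .inl (by rw [hq, map_zero])
  have hfin : {p : ℕ | p ∣ q.num.natAbs * q.den}.Finite :=
    (Set.finite_Iic (q.num.natAbs * q.den)).subset fun p hp ↦
      Nat.le_of_dvd (by simpa [Nat.pos_iff_ne_zero] using hq) hp
  filter_upwards [hfin.compl_mem_cofinite] with p hp hprime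
  have hpr : p.Prime := Fact.out
  simp only [Set.mem_compl_iff, Set.mem_ofPred_eq, hpr.dvd_mul, not_or] at hp
  have hnorm : ‖algebraMap ℚ ℚ_[p] q‖ = 1 := by
    have h1 : ‖((q.num : ℤ) : ℚ_[p])‖ = 1 := by
      rw [Padic.norm_intCast_eq_one_iff, Int.isCoprime_iff_gcd_eq_one]
      exact Nat.Coprime.symm (hpr.coprime_iff_not_dvd.mpr hp.1)
    have h2 : ‖((q.den : ℕ) : ℚ_[p])‖ = 1 :=
      Padic.norm_natCast_eq_one_iff.mpr (hpr.coprime_iff_not_dvd.mpr hp.2)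
    rw [eq_ratCast, Rat.cast_def, norm_div, h1, h2, div_one]
  exact .inr ⟨PadicInt.mkUnits hnorm, rfl⟩

theorem eventually_forall_isZeroOrUnit {S : Set ℚ} (hS : S.Finite) :
    ∀ᶠ p : ℕ in cofinite, ∀ _ : Fact p.Prime, ∀ q ∈ S,
      IsZeroOrUnit ℤ_[p] (algebraMap ℚ ℚ_[p] q) := by
  have := (eventually_all_finite hS).mpr fun q _ ↦ eventually_isZeroOrUnit q
  filter_upwards [this] with p hp hprime q hq using hp q hq hprime

theorem xCoord_map {F K : Type*} [Field F] [Field K] [Algebra F K] [DecidableEq F] [DecidableEq K]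
    (W : WeierstrassCurve F) (P : (W⁄F).toAffine.Point) :
    xCoord (Affine.Point.map (W' := W.toAffine) (Algebra.ofId F K) P) =
      algebraMap F K (xCoord P) := by
  rcases P with _ | _
  · exact (map_zero _).symm
  · rfl

theorem yCoord_map {F K : Type*} [Field F] [Field K] [Algebra F K] [DecidableEq F] [DecidableEq K]
    (W : WeierstrassCurve F) (P : (W⁄F).toAffine.Point) :
    yCoord (Affine.Point.map (W' := W.toAffine) (Algebra.ofId F K) P) =
      algebraMap F K (yCoord P) := by
  rcases P with _ | _
  · exact (map_zero _).symm
  · rfl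

theorem exists_variableChange_eq_reductionAt {p : ℕ} [Fact p.Prime] (hp : 5 ≤ p)
    {E : WeierstrassCurve ℚ} (hE : E.HasGoodReductionAt p) {W : WeierstrassCurve ℤ_[p]}
    (hW : W⁄ℚ_[p] = E⁄ℚ_[p]) (hΔ : IsUnit W.Δ) :
    ∃ C : VariableChange (ZMod p), C • W.map PadicInt.toZMod = E.reductionAt p := by
  have hM : IsUnit (((E⁄ℚ_[p]).minimal ℤ_[p]).integralModel ℤ_[p]).Δ := by
    have := (hasGoodReduction_iff_isElliptic_reduction ℤ_[p]).mp hE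
    have := (isElliptic_iff _).mp this
    rw [reduction, map_Δ] at this
    exact isUnit_of_map_unit _ _ this
  obtain ⟨D, hD⟩ := exists_padicInt_variableChange hp hΔ hM
    -- This is the change of variables that defines `minimal`.
    (C := ((E⁄ℚ_[p]).exists_isMinimal ℤ_[p]).choose)
    (by rw [baseChange_integralModel_eq, hW]; rfl)
  refine ⟨D.map PadicInt.toZMod, ?_⟩
  rw [map_variableChange, hD, PadicInt.toZMod_eq_residueField_comp_residue, ← map_map]
  rfl

theorem not_isAnomalousPrime_of_nsmul_eq_zero {p : ℕ} [Fact p.Prime] (hp : 7 ≤ p)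
    {E : WeierstrassCurve ℚ} {W : WeierstrassCurve ℤ_[p]} (hW : W⁄ℚ_[p] = E⁄ℚ_[p])
    (hΔ : IsUnit W.Δ) {n : ℕ} (hpn : n.Coprime p)
    {P : (W.map (PadicInt.toZMod (p := p))).toAffine.Point} (hP : P ≠ 0) (hnP : n • P = 0) :
    ¬ E.IsAnomalousPrime p := by
  rintro ⟨_, hgood, Q, hQ, hpQ⟩
  have : (W.map (PadicInt.toZMod (p := p))).IsElliptic :=
    (isElliptic_iff _).mpr (by rw [map_Δ]; exact hΔ.map _)
  obtain ⟨C, hC⟩ := exists_variableChange_eq_reductionAt (by lia) hgood hW hΔ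
  have hdvd : p ∣ Nat.card (E.reductionAt p).toAffine.Point :=
    (addOrderOf_eq_prime hpQ hQ).symm.dvd.trans (addOrderOf_dvd_natCard Q)
  rw [← hC, card_point_variableChange] at hdvd
  have hcard := card_point_eq_of_dvd hp _ hdvd
  have hord : addOrderOf P ∣ p := (addOrderOf_dvd_natCard P).trans hcard.dvd
  have := Nat.dvd_gcd (addOrderOf_dvd_of_nsmul_eq_zero hnP) hord
  rw [hpn.gcd_eq_one, Nat.dvd_one, AddMonoid.addOrderOf_eq_one_iff] at this
  exact hP this

theorem exists_padicInt_model {p : ℕ} [Fact p.Prime] {E : WeierstrassCurve ℚ} [E.IsElliptic]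
    (h : ∀ q ∈ ({E.a₁, E.a₂, E.a₃, E.a₄, E.a₆, E.Δ} : Set ℚ),
      IsZeroOrUnit ℤ_[p] (algebraMap ℚ ℚ_[p] q)) :
    ∃ W : WeierstrassCurve ℤ_[p], W⁄ℚ_[p] = E⁄ℚ_[p] ∧ IsUnit W.Δ := by
  obtain ⟨r₁, h₁⟩ := (h E.a₁ (by simp)).exists_eq
  obtain ⟨r₂, h₂⟩ := (h E.a₂ (by simp)).exists_eq
  obtain ⟨r₃, h₃⟩ := (h E.a₃ (by simp)).exists_eq
  obtain ⟨r₄, h₄⟩ := (h E.a₄ (by simp)).exists_eq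
  obtain ⟨r₆, h₆⟩ := (h E.a₆ (by simp)).exists_eq
  have hW : (⟨r₁, r₂, r₃, r₄, r₆⟩ : WeierstrassCurve ℤ_[p])⁄ℚ_[p] = E⁄ℚ_[p] := by
    ext <;> assumption
  have hΔ := congrArg Δ hW
  simp only [baseChange, map_Δ] at hΔ
  refine ⟨_, hW, isUnit_of_isZeroOrUnit (IsFractionRing.injective ℤ_[p] ℚ_[p]) ?_
    (hΔ ▸ h E.Δ (by simp))⟩
  intro h0
  rw [h0, map_zero] at hΔ
  exact E.isUnit_Δ.ne_zero ((map_eq_zero _).mp hΔ.symm)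

theorem isRidgdill_of_nsmul_eq_zero (E : WeierstrassCurve ℚ) [E.IsElliptic]
    {P : (E⁄ℚ).toAffine.Point} (hP : P ≠ 0) {n : ℕ} (hn : n ≠ 0) (hnP : n • P = 0) :
    E.IsRidgdill := by
  classical
  -- Torsion enters here: finitely many multiples impose finitely many conditions on `p`.
  have hmul : (Set.range fun m : ℕ ↦ m • P).Finite := by
    refine ((Finset.range n).finite_toSet.image fun m : ℕ ↦ m • P).subset ?_
    rintro _ ⟨m, rfl⟩
    refine ⟨m % n, by simpa using Nat.mod_lt m (Nat.pos_of_ne_zero hn), ?_⟩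
    dsimp only
    conv_rhs => rw [← Nat.mod_add_div m n, add_smul, mul_comm, mul_smul, hnP, nsmul_zero, add_zero]
  have hcoeff := eventually_forall_isZeroOrUnit
    (Set.toFinite ({E.a₁, E.a₂, E.a₃, E.a₄, E.a₆, E.Δ} : Set ℚ))
  have hx := eventually_forall_isZeroOrUnit (hmul.image fun Q ↦ xCoord Q - xCoord P)
  have hy := eventually_forall_isZeroOrUnit
    (hmul.image fun Q ↦ yCoord Q - (E⁄ℚ).toAffine.negY (xCoord P) (yCoord P))
  have hfin : {p : ℕ | p < 7 ∨ p ∣ n}.Finite :=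
    (Set.finite_Iio 7).union ((Set.finite_Iic n).subset fun p hp ↦ Nat.le_of_dvd (by lia) hp)
  suffices h : ∀ᶠ p : ℕ in cofinite, ¬ E.IsAnomalousPrime p by
    simpa [IsRidgdill, eventually_cofinite] using h
  filter_upwards [hcoeff, hx, hy, eventually_isZeroOrUnit (xCoord P),
    eventually_isZeroOrUnit (yCoord P), hfin.compl_mem_cofinite] with p hcoeff hx hy hPx hPy hpn
  rintro ⟨hprime, hanom⟩
  simp only [Set.mem_compl_iff, Set.mem_ofPred_eq, not_or, not_lt] at hpn
  obtain ⟨W, hW, hΔ⟩ := exists_padicInt_model (hcoeff hprime)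
  have : (W.map (PadicInt.toZMod (p := p))).IsElliptic :=
    (isElliptic_iff _).mpr (by rw [map_Δ]; exact hΔ.map _)
  have hneg (x y : ℚ) : (E⁄ℚ_[p]).toAffine.negY (algebraMap ℚ ℚ_[p] x) (algebraMap ℚ ℚ_[p] y) =
      algebraMap ℚ ℚ_[p] ((E⁄ℚ).toAffine.negY x y) :=
    Affine.baseChange_negY (W' := E.toAffine) (Algebra.ofId ℚ ℚ_[p]) x y
  let ι := Affine.Point.map (W' := E.toAffine) (Algebra.ofId ℚ ℚ_[p])
  have hιP : ι P ≠ 0 := (map_ne_zero_iff ι (Affine.Point.map_injective _)).mpr hP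
  obtain ⟨P', hP', hnP'⟩ := W.exists_nsmul_eq_zero_of_isZeroOrUnit hW PadicInt.toZMod
    (IsFractionRing.injective ℤ_[p] ℚ_[p]) hιP (n := n) (by rw [← map_nsmul, hnP, map_zero])
    (by rw [xCoord_map]; exact hPx hprime) (by rw [yCoord_map]; exact hPy hprime)
    (fun m ↦ by
      rw [← map_nsmul, xCoord_map, xCoord_map, ← map_sub]
      exact hx hprime _ ⟨_, ⟨m, rfl⟩, rfl⟩)
    (fun m ↦ by
      rw [← map_nsmul, yCoord_map, xCoord_map, yCoord_map, hneg, ← map_sub]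
      exact hy hprime _ ⟨_, ⟨m, rfl⟩, rfl⟩)
  exact not_isAnomalousPrime_of_nsmul_eq_zero hpn.1 hW hΔ
    ((Nat.coprime_comm.mp (hprime.out.coprime_iff_not_dvd.mpr hpn.2))) hP' hnP' ⟨hprime, hanom⟩

end WeierstrassCurve

theorem mainTheorem11 (E : WeierstrassCurve ℚ) [E.IsElliptic]
    (hE : AddCommGroup.torsion E.toAffine.Point ≠ ⊥) :
    E.IsRidgdill := by
  obtain ⟨P, hP, hP0⟩ := (AddSubgroup.ne_bot_iff_exists_ne_zero).mp hE |> fun ⟨P, h⟩ ↦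
    (⟨P.1, P.2, fun h0 ↦ h (Subtype.ext h0)⟩ :
      ∃ P : E.toAffine.Point, P ∈ AddCommGroup.torsion E.toAffine.Point ∧ P ≠ 0)
  obtain ⟨n, hn, hnP⟩ := isOfFinAddOrder_iff_nsmul_eq_zero.mp hP
  exact E.isRidgdill_of_nsmul_eq_zero (P := P) hP0 hn.ne' hnP
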